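/- **Szemerédi's regularity lemma.** For a finite simple graph $H=(V,E)$ and nonempty $C,D\subseteq V$, let $e(C,D)$ be the number of pairs $(u,v)\in C\times D$ with $u,v$ adjacent, and let $d(C,D)=e(C,D)/(|C||D|)$. For $\varepsilon>0$, a partition $Q$ of $V$ into nonempty classes is called $\varepsilon$-balanced if there is a subcollection $Q'\subseteq Q$ with $|\bigcup Q'|\le\varepsilon|V|$ such that all classes in $Q\setminus Q'$ have the same cardinality. For each real $\varepsilon>0$ and each $p\in\mathbb{N}$ there exists $k_{p,\varepsilon}\in\mathbb{N}$ such that for each finite simple graph $H=(V,E)$ with $V\neq\emptyset$ and each partition $P$ of $V$ with $|P|=p$ there is an $\varepsilon$-balanced refinement $Q$ of $P$ with $|Q|\le k_{p,\varepsilon}$ and $$\sum_{A,B\in Q}\ \max_{\emptyset\ne C\subseteq A,\ \emptyset\ne D\subseteq B}|C||D|\cdot|d(C,D)-d(A,B)|\;<\;\varepsilon|V|^2,$$ where the sum is over all ordered pairs $(A,B)\in Q\times Q$, including $A=B$. -/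

import Mathlib

/-- A collection of finite sets is balanced if all its members have the same cardinality. -/
def IsBalanced {V : Type*} (P : Finset (Finset V)) : Prop :=
  ∀ A ∈ P, ∀ B ∈ P, A.card = B.card

/-- A partition `P` of the finite set `V` is `ε`-balanced if some subcollection `P'` of its classes
covers at most `ε |V|` elements and `P \ P'` is balanced. -/
def IsEpsBalanced {V : Type*} [Fintype V] [DecidableEq V] (ε : ℝ)
    (P : Finpartition (Finset.univ : Finset V)) : Prop :=
  ∃ P' ⊆ P.parts, IsBalanced (P.parts \ P') ∧
    ((P'.biUnion id).card : ℝ) ≤ ε * (Fintype.card V : ℝ)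

/-- `|C| |D| |d(C,D) - d(A,B)|`, where `d(C,D)` is the number of pairs in `C × D` that are adjacent
in `H`, divided by `|C| |D|`. -/
noncomputable def densityDeviation {V : Type*} (H : SimpleGraph V) [DecidableRel H.Adj]
    (A B C D : Finset V) : ℝ :=
  (C.card : ℝ) * (D.card : ℝ) * |(H.edgeDensity C D : ℝ) - (H.edgeDensity A B : ℝ)|

/-- The maximum of `|C| |D| |d(C,D) - d(A,B)|` over nonempty `C ⊆ A` and nonempty `D ⊆ B`.
It is attained when `A` and `B` are nonempty, see `isGreatest_maxDeviation`. -/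
noncomputable def maxDeviation {V : Type*} (H : SimpleGraph V) [DecidableRel H.Adj]
    (A B : Finset V) : ℝ :=
  sSup {x : ℝ | ∃ C D : Finset V, C.Nonempty ∧ C ⊆ A ∧ D.Nonempty ∧ D ⊆ B ∧
    x = densityDeviation H A B C D}

theorem isGreatest_maxDeviation {V : Type*} (H : SimpleGraph V) [DecidableRel H.Adj]
    {A B : Finset V} (hA : A.Nonempty) (hB : B.Nonempty) :
    IsGreatest {x : ℝ | ∃ C D : Finset V, C.Nonempty ∧ C ⊆ A ∧ D.Nonempty ∧ D ⊆ B ∧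
      x = densityDeviation H A B C D} (maxDeviation H A B) := by
  set S := {x : ℝ | ∃ C D : Finset V, C.Nonempty ∧ C ⊆ A ∧ D.Nonempty ∧ D ⊆ B ∧
      x = densityDeviation H A B C D} with hS
  have hfin : S.Finite := by
    refine (((A.powerset ×ˢ B.powerset).finite_toSet).image
      (fun p => densityDeviation H A B p.1 p.2)).subset ?_
    rintro x ⟨C, D, -, hC, -, hD, rfl⟩
    exact ⟨(C, D), by simp [hC, hD], rfl⟩
  have hne : S.Nonempty :=
    ⟨_, A, B, hA, Finset.Subset.refl _, hB, Finset.Subset.refl _, rfl⟩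
  exact ⟨hne.csSup_mem hfin, fun x hx => le_csSup hfin.bddAbove hx⟩

/-!
Partitions are compared through their energy: the squared `ℓ²`-norm of the adjacency matrix after
averaging over the cells `A × B`. Averaging is an orthogonal projection, so refining a partition
raises the energy by exactly the squared distance between the two averaged matrices. If the
deviations of `Q` add up to at least `ε |V| ^ 2`, cut `Q` along the extremal sets `C` and `D` of all
pairs of classes: by the Cauchy–Schwarz inequality the energy then grows by at least
`(ε |V|) ^ 2`. As the energy never exceeds `|V| ^ 2`, alternately making the partition balanced
and cutting it must stop after at most `1 / ε ^ 2` cuts.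
-/

open Finset
open scoped BigOperators

section FactorsThrough

theorem factorsThrough_prodMap {α β ι κ γ δ : Type*} {f : α → ι} {g : β → κ} {f' : α → γ}
    {g' : β → δ} (hf : f.FactorsThrough f') (hg : g.FactorsThrough g') :
    (Prod.map f g).FactorsThrough (Prod.map f' g') := fun _ _ h =>
  Prod.ext (hf (congrArg Prod.fst h)) (hg (congrArg Prod.snd h))

theorem mem_product_factorsThrough_prodMap {α β ι κ : Type*} {c : α → ι} {d : β → κ}
    {C : Finset α} {D : Finset β} (hC : (· ∈ C).FactorsThrough c)
    (hD : (· ∈ D).FactorsThrough d) : (· ∈ C ×ˢ D).FactorsThrough (Prod.map c d) := fun x y h => by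
  simpa only [mem_product] using
    congrArg₂ And (hC (congrArg Prod.fst h)) (hD (congrArg Prod.snd h))

theorem part_factorsThrough_part_of_le {α : Type*} [DecidableEq α] {s : Finset α}
    {P Q : Finpartition s} (h : Q ≤ P) : P.part.FactorsThrough Q.part := fun a b hab => by
  by_cases ha : a ∈ s
  · have hb : b ∈ s := by rwa [← Q.part_mem, ← hab, Q.part_mem]
    obtain ⟨B, hB, hle⟩ := h (Q.part_mem.2 ha)
    rw [P.part_eq_of_mem hB (hle (Q.mem_part_self.2 ha)),
      P.part_eq_of_mem hB (hle (hab ▸ Q.mem_part_self.2 hb))]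
  · have hb : b ∉ s := by rwa [← Q.part_eq_empty, ← hab, Q.part_eq_empty]
    rw [P.part_eq_empty.2 ha, P.part_eq_empty.2 hb]

end FactorsThrough

section FiberAverage

variable {α ι κ M 𝕜 : Type*} [Fintype α] [DecidableEq ι] [DecidableEq κ]

/-- The conditional expectation of `f` given `c` under the uniform distribution on `α`: at `a` it is
the average of `f` over the fiber of `c` that contains `a`. A partition enters through the map `c`
that sends a point to its class, and `g.FactorsThrough c` says that `g` is constant on the
classes. -/
def fiberAverage [AddCommMonoid M] [Module ℚ≥0 M] (c : α → ι) (f : α → M) (a : α) : M :=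
  𝔼 x with c x = c a, f x

theorem fiberAverage_factorsThrough [AddCommMonoid M] [Module ℚ≥0 M] (c : α → ι) (f : α → M) :
    (fiberAverage c f).FactorsThrough c := fun a b h => by
  simp only [fiberAverage, h]

theorem fiberAverage_id [DecidableEq α] [AddCommMonoid M] [Module ℚ≥0 M] (f : α → M) :
    fiberAverage id f = f := by
  ext a
  simp [fiberAverage, filter_eq']

theorem sum_fiberAverage [AddCommMonoid M] [Module ℚ≥0 M] (c : α → ι) (f : α → M) :
    ∑ a, fiberAverage c f a = ∑ a, f a := by
  have hc : ∀ a ∈ univ, c a ∈ univ.image c := fun a ha => mem_image_of_mem c ha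
  rw [← sum_fiberwise_of_maps_to hc, ← sum_fiberwise_of_maps_to hc]
  refine sum_congr rfl fun i _ => ?_
  have hconst : ∀ a ∈ ({a | c a = i} : Finset α), fiberAverage c f a = 𝔼 x with c x = i, f x :=
    fun a ha => by rw [fiberAverage, (mem_filter.1 ha).2]
  rw [sum_congr rfl hconst, sum_const, card_smul_expect]

section Field

variable [Field 𝕜] [CharZero 𝕜] {c : α → ι} {c' : α → κ} {f g : α → 𝕜}

theorem fiberAverage_mul_of_factorsThrough (hg : g.FactorsThrough c) (a : α) :
    fiberAverage c f a * g a = fiberAverage c (fun x => f x * g x) a := by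
  rw [fiberAverage, expect_mul]
  exact expect_congr rfl fun x hx => by rw [hg (mem_filter.1 hx).2]

theorem sum_fiberAverage_mul_of_factorsThrough (hg : g.FactorsThrough c) :
    ∑ a, fiberAverage c f a * g a = ∑ a, f a * g a := by
  simp only [fiberAverage_mul_of_factorsThrough hg, sum_fiberAverage]

theorem sum_mem_fiberAverage_of_factorsThrough {S : Finset α} (hS : (· ∈ S).FactorsThrough c) :
    ∑ a ∈ S, fiberAverage c f a = ∑ a ∈ S, f a := by
  classical
  have h := sum_fiberAverage_mul_of_factorsThrough (f := f)
    (hS.comp_left fun q : Prop => if q then (1 : 𝕜) else 0)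
  simpa using h

/-- The squared `ℓ²`-norm of `fiberAverage c f`, the quantity that increases under refinement. -/
def fiberEnergy (c : α → ι) (f : α → 𝕜) : 𝕜 :=
  ∑ a, fiberAverage c f a ^ 2

theorem sum_sq_fiberAverage_sub (h : c.FactorsThrough c') :
    ∑ a, (fiberAverage c' f a - fiberAverage c f a) ^ 2 = fiberEnergy c' f - fiberEnergy c f := by
  have hc := fiberAverage_factorsThrough c f
  have hcross : ∑ a, fiberAverage c' f a * fiberAverage c f a = fiberEnergy c f :=
    calc ∑ a, fiberAverage c' f a * fiberAverage c f a
        = ∑ a, f a * fiberAverage c f a :=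
          sum_fiberAverage_mul_of_factorsThrough fun _ _ hab => hc (h hab)
      _ = ∑ a, fiberAverage c f a * fiberAverage c f a :=
          (sum_fiberAverage_mul_of_factorsThrough hc).symm
      _ = fiberEnergy c f := by simp only [fiberEnergy, sq]
  simp only [sub_sq, sum_add_distrib, sum_sub_distrib, mul_assoc, ← mul_sum, hcross]
  simp only [fiberEnergy]
  ring

end Field

section OrderedField

variable [Field 𝕜] [LinearOrder 𝕜] [IsStrictOrderedRing 𝕜] {c : α → ι} {c' : α → κ} {f : α → 𝕜}

theorem fiberEnergy_nonneg (c : α → ι) (f : α → 𝕜) : 0 ≤ fiberEnergy c f :=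
  sum_nonneg fun _ _ => sq_nonneg _

theorem fiberEnergy_le_of_factorsThrough (h : c.FactorsThrough c') :
    fiberEnergy c f ≤ fiberEnergy c' f := by
  rw [← sub_nonneg, ← sum_sq_fiberAverage_sub h]
  exact sum_nonneg fun _ _ => sq_nonneg _

theorem fiberEnergy_le_sum_sq (c : α → ι) (f : α → 𝕜) : fiberEnergy c f ≤ ∑ a, f a ^ 2 := by
  classical
  calc fiberEnergy c f ≤ fiberEnergy id f :=
        fiberEnergy_le_of_factorsThrough (Function.injective_id.factorsThrough c)
    _ = ∑ a, f a ^ 2 := by rw [fiberEnergy, fiberAverage_id]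

/-- On `S i` the function `f` may be replaced by its finer average, since both have the same sum;
the Cauchy–Schwarz inequality does the rest. -/
theorem sq_sum_abs_sum_sub_fiberAverage_le {τ : Type*} {t : Finset τ} {S : τ → Finset α}
    (h : c.FactorsThrough c') (hdisj : (t : Set τ).PairwiseDisjoint S)
    (hS : ∀ i ∈ t, (· ∈ S i).FactorsThrough c') :
    (∑ i ∈ t, |∑ a ∈ S i, (f a - fiberAverage c f a)|) ^ 2 ≤
      Fintype.card α * (fiberEnergy c' f - fiberEnergy c f) := by
  classical
  set g : α → 𝕜 := fun a => fiberAverage c' f a - fiberAverage c f a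
  have hsum : ∑ i ∈ t, |∑ a ∈ S i, (f a - fiberAverage c f a)| ≤ ∑ a, |g a| :=
    calc ∑ i ∈ t, |∑ a ∈ S i, (f a - fiberAverage c f a)|
        = ∑ i ∈ t, |∑ a ∈ S i, g a| := sum_congr rfl fun i hi => by
          simp only [g, sum_sub_distrib, sum_mem_fiberAverage_of_factorsThrough (hS i hi)]
      _ ≤ ∑ i ∈ t, ∑ a ∈ S i, |g a| := sum_le_sum fun i _ => abs_sum_le_sum_abs _ _
      _ = ∑ a ∈ t.biUnion S, |g a| := (sum_biUnion hdisj).symm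
      _ ≤ ∑ a, |g a| :=
          sum_le_sum_of_subset_of_nonneg (subset_univ _) fun a _ _ => abs_nonneg _
  calc (∑ i ∈ t, |∑ a ∈ S i, (f a - fiberAverage c f a)|) ^ 2
      ≤ (∑ a, |g a|) ^ 2 := pow_le_pow_left₀ (sum_nonneg fun i _ => abs_nonneg _) hsum 2
    _ ≤ Fintype.card α * ∑ a, |g a| ^ 2 := sq_sum_le_card_mul_sum_sq
    _ = Fintype.card α * (fiberEnergy c' f - fiberEnergy c f) := by
      simp only [sq_abs, g, sum_sq_fiberAverage_sub h]

end OrderedField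

end FiberAverage

section AdjIndicator

variable {V : Type*} (H : SimpleGraph V) [DecidableRel H.Adj]

/-- The adjacency matrix of `H`, as a function on the ordered pairs of vertices. -/
def adjIndicator (e : V × V) : ℝ :=
  if H.Adj e.1 e.2 then 1 else 0

theorem expect_product_adjIndicator (C D : Finset V) :
    𝔼 e ∈ C ×ˢ D, adjIndicator H e = H.edgeDensity C D := by
  simp [expect_eq_sum_div_card, adjIndicator, SimpleGraph.edgeDensity_def,
    SimpleGraph.interedges_def]

theorem sum_product_adjIndicator (C D : Finset V) :
    ∑ e ∈ C ×ˢ D, adjIndicator H e = #C * #D * H.edgeDensity C D := by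
  rw [← card_mul_expect, expect_product_adjIndicator, card_product, Nat.cast_mul]

variable [Fintype V] [DecidableEq V] {Q R : Finpartition (univ : Finset V)} {A B : Finset V}

theorem fiberAverage_part_adjIndicator (hA : A ∈ Q.parts) (hB : B ∈ Q.parts) {e : V × V}
    (he : e ∈ A ×ˢ B) :
    fiberAverage (Prod.map Q.part Q.part) (adjIndicator H) e = H.edgeDensity A B := by
  obtain ⟨heA, heB⟩ := mem_product.1 he
  have hcell : ({x | Prod.map Q.part Q.part x = Prod.map Q.part Q.part e} : Finset (V × V)) =
      A ×ˢ B := by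
    ext x
    simp [Prod.ext_iff, Q.part_eq_of_mem hA heA, Q.part_eq_of_mem hB heB, Q.part_eq_iff_mem hA,
      Q.part_eq_iff_mem hB]
  rw [fiberAverage, hcell, expect_product_adjIndicator]

theorem densityDeviation_eq_abs_sum_sub_fiberAverage (hA : A ∈ Q.parts) (hB : B ∈ Q.parts)
    {C D : Finset V} (hC : C ⊆ A) (hD : D ⊆ B) :
    densityDeviation H A B C D = |∑ e ∈ C ×ˢ D,
      (adjIndicator H e - fiberAverage (Prod.map Q.part Q.part) (adjIndicator H) e)| := by
  have hconst := fun e (he : e ∈ C ×ˢ D) =>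
    fiberAverage_part_adjIndicator H hA hB (product_subset_product hC hD he)
  rw [sum_sub_distrib, sum_product_adjIndicator, sum_congr rfl hconst, sum_const, card_product,
    nsmul_eq_mul, Nat.cast_mul, ← mul_sub, abs_mul, abs_of_nonneg (by positivity),
    densityDeviation]

/-- The energy of the average of the adjacency matrix over the cells `A × B` with `A` and `B` in
`Q`. Unlike in `Finpartition.energy`, each cell is weighted by its size and the diagonal cells
count. -/
noncomputable def partitionEnergy (Q : Finpartition (univ : Finset V)) : ℝ :=
  fiberEnergy (Prod.map Q.part Q.part) (adjIndicator H)

theorem partitionEnergy_nonneg (Q : Finpartition (univ : Finset V)) : 0 ≤ partitionEnergy H Q :=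
  fiberEnergy_nonneg _ _

theorem partitionEnergy_anti (h : R ≤ Q) : partitionEnergy H Q ≤ partitionEnergy H R :=
  fiberEnergy_le_of_factorsThrough <|
    factorsThrough_prodMap (part_factorsThrough_part_of_le h) (part_factorsThrough_part_of_le h)

theorem partitionEnergy_le (Q : Finpartition (univ : Finset V)) :
    partitionEnergy H Q ≤ (Fintype.card V : ℝ) ^ 2 :=
  calc partitionEnergy H Q ≤ ∑ e, adjIndicator H e ^ 2 := fiberEnergy_le_sum_sq _ _
    _ ≤ ∑ _e : V × V, (1 : ℝ) := sum_le_sum fun e _ => by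
      unfold adjIndicator
      split_ifs <;> norm_num
    _ = (Fintype.card V : ℝ) ^ 2 := by simp [sq]

theorem sq_sum_densityDeviation_le {C D : Finset V × Finset V → Finset V} (h : R ≤ Q)
    (hsub : ∀ p ∈ Q.parts ×ˢ Q.parts, C p ⊆ p.1 ∧ D p ⊆ p.2)
    (hfac : ∀ p ∈ Q.parts ×ˢ Q.parts,
      (· ∈ C p).FactorsThrough R.part ∧ (· ∈ D p).FactorsThrough R.part) :
    (∑ p ∈ Q.parts ×ˢ Q.parts, densityDeviation H p.1 p.2 (C p) (D p)) ^ 2 ≤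
      (Fintype.card V : ℝ) ^ 2 * (partitionEnergy H R - partitionEnergy H Q) := by
  have hdisj : (↑(Q.parts ×ˢ Q.parts) : Set (Finset V × Finset V)).PairwiseDisjoint
      fun p => C p ×ˢ D p := by
    intro p hp q hq hpq
    have hp' := mem_product.1 (mem_coe.1 hp)
    have hq' := mem_product.1 (mem_coe.1 hq)
    rw [Function.onFun, disjoint_product]
    by_cases h₁ : p.1 = q.1
    · exact .inr <| (Q.disjoint hp'.2 hq'.2 fun h₂ => hpq (Prod.ext h₁ h₂)).mono
        (hsub p hp).2 (hsub q hq).2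
    · exact .inl <| (Q.disjoint hp'.1 hq'.1 h₁).mono (hsub p hp).1 (hsub q hq).1
  have hdev : ∀ p ∈ Q.parts ×ˢ Q.parts, densityDeviation H p.1 p.2 (C p) (D p) =
      |∑ e ∈ C p ×ˢ D p,
        (adjIndicator H e - fiberAverage (Prod.map Q.part Q.part) (adjIndicator H) e)| :=
    fun p hp => densityDeviation_eq_abs_sum_sub_fiberAverage H (mem_product.1 hp).1
      (mem_product.1 hp).2 (hsub p hp).1 (hsub p hp).2
  have hcard : (Fintype.card V : ℝ) ^ 2 = Fintype.card (V × V) := by simp [sq]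
  rw [sum_congr rfl hdev, hcard]
  exact sq_sum_abs_sum_sub_fiberAverage_le
    (factorsThrough_prodMap (part_factorsThrough_part_of_le h) (part_factorsThrough_part_of_le h))
    hdisj fun p hp => mem_product_factorsThrough_prodMap (hfac p hp).1 (hfac p hp).2

end AdjIndicator

section Increment

theorem mem_iff_mem_of_mem_atomise {α : Type*} [DecidableEq α] {s : Finset α}
    {F : Finset (Finset α)} {X C : Finset α} (hX : X ∈ (Finpartition.atomise s F).parts)
    (hC : C ∈ F) {x y : α} (hx : x ∈ X) (hy : y ∈ X) : x ∈ C ↔ y ∈ C := by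
  obtain ⟨-, G, -, rfl⟩ := Finpartition.mem_atomise.1 hX
  exact ((mem_filter.1 hx).2 C hC).symm.trans ((mem_filter.1 hy).2 C hC)

theorem mem_factorsThrough_part_atomise {α : Type*} [Fintype α] [DecidableEq α]
    {F : Finset (Finset α)} {C : Finset α} (hC : C ∈ F) :
    (· ∈ C).FactorsThrough (Finpartition.atomise univ F).part := fun x y hxy => by
  set R := Finpartition.atomise univ F
  exact propext <| mem_iff_mem_of_mem_atomise (R.part_mem.2 (mem_univ x)) hC
    (R.mem_part_self.2 (mem_univ x)) (hxy ▸ R.mem_part_self.2 (mem_univ y))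

theorem exists_le_forall_mem_factorsThrough_part {α : Type*} [Fintype α] [DecidableEq α]
    (Q : Finpartition (univ : Finset α)) (F : Finset (Finset α)) :
    ∃ R ≤ Q, #R.parts ≤ #Q.parts * 2 ^ #F ∧ ∀ C ∈ F, (· ∈ C).FactorsThrough R.part := by
  refine ⟨Q ⊓ Finpartition.atomise univ F, inf_le_left, ?_, fun C hC a b hab =>
    mem_factorsThrough_part_atomise hC (part_factorsThrough_part_of_le inf_le_right hab)⟩
  calc #(Q ⊓ Finpartition.atomise univ F).parts
      ≤ #(Q.parts ×ˢ (Finpartition.atomise univ F).parts) := by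
        rw [Finpartition.parts_inf]
        exact card_erase_le.trans card_image_le
    _ ≤ #Q.parts * 2 ^ #F := by
        rw [card_product]
        exact Nat.mul_le_mul_left _ Finpartition.card_atomise_le

variable {V : Type*} (H : SimpleGraph V) [DecidableRel H.Adj]

theorem exists_maxDeviation_eq_densityDeviation {A B : Finset V} (hA : A.Nonempty)
    (hB : B.Nonempty) :
    ∃ C D, (C ⊆ A ∧ D ⊆ B) ∧ maxDeviation H A B = densityDeviation H A B C D :=
  let ⟨C, D, _, hC, _, hD, heq⟩ := (isGreatest_maxDeviation H hA hB).1
  ⟨C, D, ⟨hC, hD⟩, heq⟩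

theorem exists_le_sq_sum_maxDeviation_le [Fintype V] [DecidableEq V]
    (Q : Finpartition (univ : Finset V)) :
    ∃ R ≤ Q, #R.parts ≤ #Q.parts * 2 ^ (2 * #Q.parts ^ 2) ∧
      (∑ A ∈ Q.parts, ∑ B ∈ Q.parts, maxDeviation H A B) ^ 2 ≤
        (Fintype.card V : ℝ) ^ 2 * (partitionEnergy H R - partitionEnergy H Q) := by
  choose! C D hsub hmax using fun (p : Finset V × Finset V) (hp : p ∈ Q.parts ×ˢ Q.parts) =>
    exists_maxDeviation_eq_densityDeviation H (Q.nonempty_of_mem_parts (mem_product.1 hp).1)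
      (Q.nonempty_of_mem_parts (mem_product.1 hp).2)
  set F := (Q.parts ×ˢ Q.parts).image C ∪ (Q.parts ×ˢ Q.parts).image D
  have hF : #F ≤ 2 * #Q.parts ^ 2 := by
    rw [sq, ← card_product, two_mul]
    exact (card_union_le _ _).trans (add_le_add card_image_le card_image_le)
  obtain ⟨R, hRQ, hcard, hfac⟩ := exists_le_forall_mem_factorsThrough_part Q F
  refine ⟨R, hRQ, hcard.trans (by gcongr; norm_num), ?_⟩
  rw [← sum_product', sum_congr rfl hmax]
  exact sq_sum_densityDeviation_le H hRQ hsub fun p hp =>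
    ⟨hfac _ (mem_union_left _ (mem_image_of_mem C hp)),
      hfac _ (mem_union_right _ (mem_image_of_mem D hp))⟩

end Increment

section Balancing

variable {α : Type*} [DecidableEq α]

theorem exists_finpartition_sum_card_ne_le (m : ℕ) (A : Finset α) :
    ∃ R : Finpartition A, ∑ B ∈ R.parts with #B ≠ m + 1, #B ≤ m ∧
      #R.parts * (m + 1) ≤ #A + m := by
  induction A using Finset.strongInduction with
  | H A ih =>
  rcases le_or_gt #A m with hA | hA
  · rcases A.eq_empty_or_nonempty with rfl | hne
    · exact ⟨Finpartition.empty _, by simp, by simp⟩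
    · have := hne.card_pos
      refine ⟨Finpartition.indiscrete hne.ne_empty, ?_, ?_⟩
      · simpa [filter_singleton, (Nat.lt_succ_of_le hA).ne] using hA
      · simp only [Finpartition.indiscrete_parts, card_singleton]
        omega
  · obtain ⟨B, hBA, hB⟩ := exists_subset_card_eq (Nat.succ_le_of_lt hA)
    have hBne : B.Nonempty := card_pos.1 (hB ▸ m.succ_pos)
    obtain ⟨R, hrest, hcard⟩ := ih (A \ B) (sdiff_ssubset hBA hBne)
    refine ⟨R.extend hBne.ne_empty sdiff_disjoint (sdiff_union_of_subset hBA), ?_, ?_⟩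
    · rwa [Finpartition.extend_parts, filter_insert, if_neg (not_not.2 hB)]
    · have := card_sdiff_add_card_eq_card hBA
      rw [Finpartition.card_extend, add_mul]
      omega

theorem exists_le_card_biUnion_card_ne_le {s : Finset α} (P : Finpartition s) (m : ℕ) :
    ∃ Q ≤ P, #({B ∈ Q.parts | #B ≠ m + 1}.biUnion id) ≤ #P.parts * m ∧
      #Q.parts * (m + 1) ≤ #s + #P.parts * m := by
  choose R hrest hcard using exists_finpartition_sum_card_ne_le (α := α) m
  refine ⟨P.bind fun A _ => R A, fun B hB => ?_, ?_, ?_⟩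
  · obtain ⟨A, hA, hBA⟩ := Finpartition.mem_bind.1 hB
    exact ⟨A, hA, (R A).le hBA⟩
  · have hfilter : {B ∈ (P.bind fun A _ => R A).parts | #B ≠ m + 1}.biUnion id =
        P.parts.biUnion fun A => {B ∈ (R A).parts | #B ≠ m + 1}.biUnion id := by
      ext v
      simp only [mem_biUnion, mem_filter, Finpartition.mem_bind]
      tauto
    rw [hfilter]
    exact card_biUnion_le_card_mul _ _ m fun A _ => card_biUnion_le.trans (hrest A)
  · rw [Finpartition.card_bind, sum_attach P.parts fun A => #(R A).parts, sum_mul]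
    calc ∑ A ∈ P.parts, #(R A).parts * (m + 1) ≤ ∑ A ∈ P.parts, (#A + m) :=
          sum_le_sum fun A _ => hcard A
      _ = #s + #P.parts * m := by
          rw [sum_add_distrib, P.sum_card_parts, sum_const, smul_eq_mul]

/-- The number of classes that suffices to refine a partition with `p` classes to an `ε`-balanced
one. -/
noncomputable def balancingBound (ε : ℝ) (p : ℕ) : ℕ :=
  ⌊p / ε⌋₊ + p

theorem exists_isEpsBalanced_le {V : Type*} [Fintype V] [DecidableEq V] {ε : ℝ} (hε : 0 < ε)
    (P : Finpartition (univ : Finset V)) :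
    ∃ Q ≤ P, IsEpsBalanced ε Q ∧ #Q.parts ≤ balancingBound ε #P.parts := by
  set n := Fintype.card V
  set p := #P.parts
  -- The leftover pieces, of size at most `m` in each class, cover at most `p * m ≤ ε * n` points.
  set m := ⌊ε * n / p⌋₊
  obtain ⟨Q, hQP, hrest, hcard⟩ := exists_le_card_biUnion_card_ne_le P m
  have ⟨hm, hn⟩ : (p * m : ℝ) ≤ ε * n ∧ (n : ℝ) ≤ p / ε * (m + 1) := by
    rcases isEmpty_or_nonempty V with hV | hV
    · simpa [m, n] using by positivity
    · have hp : (0 : ℝ) < p := mod_cast card_pos.2 (P.parts_nonempty univ_nonempty.ne_empty)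
      have hfloor_le := Nat.floor_le (by positivity : 0 ≤ ε * n / p)
      have hlt_floor := Nat.lt_floor_add_one (ε * n / p)
      rw [le_div_iff₀' hp] at hfloor_le
      rw [div_lt_iff₀' hp] at hlt_floor
      rw [div_mul_eq_mul_div, le_div_iff₀' hε]
      exact ⟨hfloor_le, hlt_floor.le⟩
  refine ⟨Q, hQP, ⟨{B ∈ Q.parts | #B ≠ m + 1}, filter_subset _ _, fun A hA B hB => ?_, ?_⟩, ?_⟩
  · simp only [mem_sdiff, mem_filter, not_and, not_not] at hA hB
    rw [hA.2 hA.1, hB.2 hB.1]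
  · exact le_trans (mod_cast hrest) hm
  · have hcard' : (#Q.parts * (m + 1) : ℝ) ≤ n + p * m := mod_cast hcard
    rw [balancingBound, ← Nat.floor_add_natCast (by positivity)]
    refine Nat.le_floor (le_of_mul_le_mul_right ?_ (by positivity : (0 : ℝ) < m + 1))
    linarith [(Nat.cast_nonneg p : (0 : ℝ) ≤ p)]

end Balancing

section Iteration

/-- The number of classes that suffices to make a partition with `p` classes balanced and then to
cut it along the `2 * b ^ 2` sets of maximal deviation, where `b` is `balancingBound ε p`. -/
noncomputable def incrementBound (ε : ℝ) (p : ℕ) : ℕ :=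
  balancingBound ε p * 2 ^ (2 * balancingBound ε p ^ 2)

theorem balancingBound_le_incrementBound (ε : ℝ) (p : ℕ) :
    balancingBound ε p ≤ incrementBound ε p :=
  Nat.le_mul_of_pos_right _ (by positivity)

theorem id_le_incrementBound (ε : ℝ) : id ≤ incrementBound ε := fun p =>
  (Nat.le_add_left p _).trans (balancingBound_le_incrementBound ε p)

theorem incrementBound_mono {ε : ℝ} (hε : 0 ≤ ε) : Monotone (incrementBound ε) := by
  intro p q hpq
  unfold incrementBound balancingBound
  gcongr
  norm_num

variable {V : Type*} [Fintype V] [DecidableEq V] (H : SimpleGraph V) [DecidableRel H.Adj]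

theorem exists_le_sq_mul_card_le_partitionEnergy_sub [Nonempty V] {ε : ℝ} (hε : 0 ≤ ε)
    {Q : Finpartition (univ : Finset V)}
    (hQ : ε * (Fintype.card V : ℝ) ^ 2 ≤ ∑ A ∈ Q.parts, ∑ B ∈ Q.parts, maxDeviation H A B) :
    ∃ R ≤ Q, #R.parts ≤ #Q.parts * 2 ^ (2 * #Q.parts ^ 2) ∧
      (ε * Fintype.card V) ^ 2 ≤ partitionEnergy H R - partitionEnergy H Q := by
  obtain ⟨R, hRQ, hcard, hgain⟩ := exists_le_sq_sum_maxDeviation_le H Q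
  have hn : (0 : ℝ) < (Fintype.card V : ℝ) ^ 2 := by positivity
  refine ⟨R, hRQ, hcard, le_of_mul_le_mul_left ?_ hn⟩
  calc (Fintype.card V : ℝ) ^ 2 * (ε * Fintype.card V) ^ 2
      = (ε * (Fintype.card V : ℝ) ^ 2) ^ 2 := by ring
    _ ≤ (∑ A ∈ Q.parts, ∑ B ∈ Q.parts, maxDeviation H A B) ^ 2 :=
      pow_le_pow_left₀ (by positivity) hQ 2
    _ ≤ _ := hgain

theorem exists_regular_isEpsBalanced_le [Nonempty V] {ε : ℝ} (hε : 0 < ε) (m : ℕ)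
    (P : Finpartition (univ : Finset V))
    (hP : (Fintype.card V : ℝ) ^ 2 - partitionEnergy H P < m * (ε * Fintype.card V) ^ 2) :
    ∃ Q ≤ P, IsEpsBalanced ε Q ∧ #Q.parts ≤ (incrementBound ε)^[m] #P.parts ∧
      ∑ A ∈ Q.parts, ∑ B ∈ Q.parts, maxDeviation H A B < ε * (Fintype.card V : ℝ) ^ 2 := by
  induction m generalizing P with
  | zero =>
    rw [Nat.cast_zero, zero_mul, sub_neg] at hP
    exact absurd (partitionEnergy_le H P) hP.not_ge
  | succ m ih =>
    rw [Function.iterate_succ_apply]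
    obtain ⟨Q, hQP, hbal, hQcard⟩ := exists_isEpsBalanced_le hε P
    rcases lt_or_ge (∑ A ∈ Q.parts, ∑ B ∈ Q.parts, maxDeviation H A B)
      (ε * (Fintype.card V : ℝ) ^ 2) with hreg | hirreg
    · have hbound := Function.id_le_iterate_of_id_le (id_le_incrementBound ε) m
      exact ⟨Q, hQP, hbal, (hQcard.trans (balancingBound_le_incrementBound ε _)).trans (hbound _),
        hreg⟩
    obtain ⟨R, hRQ, hRcard, hgain⟩ :=
      exists_le_sq_mul_card_le_partitionEnergy_sub H hε.le hirreg
    have hR : (Fintype.card V : ℝ) ^ 2 - partitionEnergy H R < m * (ε * Fintype.card V) ^ 2 := by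
      have := partitionEnergy_anti H hQP
      push_cast at hP
      linarith
    have hRbound : #R.parts ≤ incrementBound ε #P.parts :=
      hRcard.trans (by unfold incrementBound; gcongr; norm_num)
    obtain ⟨S, hSR, hSbal, hScard, hSreg⟩ := ih R hR
    exact ⟨S, hSR.trans (hRQ.trans hQP), hSbal,
      hScard.trans ((incrementBound_mono hε.le).iterate m hRbound), hSreg⟩

end Iteration

theorem mainTheorem2 (ε : ℝ) (hε : 0 < ε) (p : ℕ) :
    ∃ k : ℕ, ∀ (V : Type*) [Fintype V] [DecidableEq V] [Nonempty V]
      (H : SimpleGraph V) [DecidableRel H.Adj]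
      (P : Finpartition (Finset.univ : Finset V)), P.parts.card = p →
      ∃ Q : Finpartition (Finset.univ : Finset V),
        Q ≤ P ∧ IsEpsBalanced ε Q ∧ Q.parts.card ≤ k ∧
        ∑ A ∈ Q.parts, ∑ B ∈ Q.parts, maxDeviation H A B < ε * (Fintype.card V : ℝ) ^ 2 := by
  obtain ⟨m, hm⟩ := exists_nat_gt (1 / ε ^ 2)
  refine ⟨(incrementBound ε)^[m] p, fun V _ _ _ H _ P hP => hP ▸
    exists_regular_isEpsBalanced_le H hε m P ?_⟩
  calc (Fintype.card V : ℝ) ^ 2 - partitionEnergy H P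
      ≤ 1 * (Fintype.card V : ℝ) ^ 2 := by linarith [partitionEnergy_nonneg H P]
    _ < m * ε ^ 2 * (Fintype.card V : ℝ) ^ 2 := by
      gcongr
      exact (div_lt_iff₀ (by positivity)).1 hm
    _ = m * (ε * Fintype.card V) ^ 2 := by ring
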